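/- **Model.** Fix a set $\mathcal E$ of events and a number $J$ of classes. A *pattern* is a nonempty finite word of events (an $l$-gram if its length is $l$); a *dictionary* $\mathcal D$ is a finite set of patterns; a *sentence* is a finite (possibly empty) word of events. A *separation* of a sentence $E$ is a finite sequence $S$ of $n_S$ pairwise distinct patterns of $\mathcal D$ whose concatenation is $E$; $\mathcal F(E)$ is the set of separations of $E$. The set of sentences generated by a set of patterns is the set of all concatenations of finite (possibly empty) sequences of pairwise distinct patterns from it. A parameter tuple is $(\mathcal D,\{\theta_{jw}\},\{\lambda_j\},\pi,\kappa)$ with $j\in\{1,\dots,J\}$, $w\in\mathcal D$, $\theta_{jw}\in[0,1]$, $\lambda_j>0$, $\pi_j>0$, $\sum_j\pi_j=1$, $\kappa>0$. A process $(e_{1:N},t_{1:N})$ is observed as a sequence of $K$ sentences $E_1,\dots,E_K$ with event times. With $\tilde t_{k,u}$ ($u=1,\dots,n_k$) the gap between the $u$-th event time of $E_k$ and the preceding event time (time $0$ before the first event), its density is $$P(e_{1:N},t_{1:N})=\frac{\kappa^{K}e^{-\kappa}}{K!}\sum_{z=1}^J\pi_z\prod_{k=1}^K\Big\{\sum_{S\in\mathcal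 F(E_k)}\frac1{n_S!}\prod_{w\in\mathcal D}\theta_{zw}^{\mathbf 1\{w\in S\}}(1-\theta_{zw})^{\mathbf 1\{w\notin S\}}\Big\}\prod_{u=1}^{n_k}\lambda_ze^{-\lambda_z\tilde t_{k,u}}$$ if all gaps are nonnegative, and $0$ otherwise. Let $\mathcal D_j=\{w\in\mathcal D:\theta_{jw}\ne0\}$, let $\mathcal O_j$ be the set of sentences generated by $\mathcal D_j$, $[j]=\{i:\lambda_i=\lambda_j\}$, $\mathcal O_{[j]}=\bigcup_{i\in[j]}\mathcal O_i$ and $\mathcal O=\bigcup_j\mathcal O_j$. **Assumptions.** (A1) For every class $j$ and event $e$, let $n_{j,e}$ be the length of the longest sentence of $\mathcal O_j$ in which $e$ does not occur; if $E\in\mathcal O_{[j]}$ contains as a contiguous subsentence some $E_1\in\mathcal O_j$ of length $n_{j,e}$ in which $e$ does not occur, then $E\in\mathcal O_j$. (A2) Every pattern of length at least $2$ in $\mathcal D$ consists of distinct events. The space $\mathfrak P$ is the set of parameter tuples that satisfy A1 and A2. **Conditions.** For a set $I$ of 1-grams of $\mathcal D$ let $T_{[j],I}$ be the matrix with entries $\theta_{ie}/(1-\theta_{ie})$,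 $e\in I$, $i\in[j]$; "$T_{[j],I}$ has full column rank" includes that all these entries are defined ($\theta_{ie}\neq1$). (C1) For each $[j]$ with $|[j]|>1$ there is a partition of the 1-grams of $\mathcal D$ into $I_1,I_2,I_3$ with $|I_k|\ge|[j]|$ such that for all $e_k\in I_k$ the sentences $(e_l,e_k)$, $l\ne k$, and $(e_1,e_2,e_3)$ each have exactly one separation, and $T_{[j],I_1},T_{[j],I_2},T_{[j],I_3}$ have full column rank. (C2) For each $[j]$ with $|[j]|>1$ and each $l$-gram $w=[e_1\dots e_l]\in\mathcal D$ with $l\ge2$ there is a set $I$ of 1-grams of $\mathcal D$ with $|I|\ge|[j]|$ such that for every $e\in I$ no separation of $(e_1,\dots,e_l,e)$ contains an $(l+1)$-gram or an $l$-gram other than $w$, and $T_{[j],I}$ has full column rank. The space $\mathfrak P^0$ is the set of elements of $\mathfrak P$ that satisfy C1 and C2. **Theorem.** Let $(\mathcal D,\{\theta_{jw}\},\{\lambda_j\},\pi,\kappa)\in\mathfrak P^0$ be such that $\mathcal D=\bigcup_j\mathcal D_j$ and every $\mathcal D_j$ is nonempty. Then it is identifiable: if $(\mathcal D',\{\theta'_{jw}\},\{\lambda'_j\},\pi',\kappa')\in\mathfrak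 P$ (with the same $J$) satisfies $P'(e_{1:N},t_{1:N})=P(e_{1:N},t_{1:N})$ for all $e_{1:N}$ and $t_{1:N}$, $\mathcal O'=\mathcal O$ and $|\mathcal D'|\le|\mathcal D|$, then $\mathcal D'=\mathcal D$, $\kappa'=\kappa$, and there is a permutation $\rho$ of $\{1,\dots,J\}$ with $\theta'_{\rho(j)w}=\theta_{jw}$, $\lambda'_{\rho(j)}=\lambda_j$ and $\pi'_{\rho(j)}=\pi_j$ for all $j$ and all $w\in\mathcal D$. -/

import Mathlib

/-!  Latent theme dictionary models.

An event is an element of `ℰ`, a pattern is a nonempty list of events, a dictionary is a finite set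
of patterns, and an event sentence is a list of events. -/

namespace LatentTheme

section Sentences

variable {ℰ : Type*} [DecidableEq ℰ]

/-- The finite sequences of pairwise distinct patterns of `D` (the empty sequence included). -/
def arrangements (D : Finset (List ℰ)) : Finset (List (List ℰ)) :=
  D.powerset.biUnion fun s => (Multiset.lists s.val).toFinset

theorem mem_arrangements {D : Finset (List ℰ)} {S : List (List ℰ)} :
    S ∈ arrangements D ↔ S.Nodup ∧ ∀ w ∈ S, w ∈ D := by
  constructor
  · intro h
    simp only [arrangements, Finset.mem_biUnion, Finset.mem_powerset, Multiset.mem_toFinset,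
      Multiset.mem_lists_iff] at h
    obtain ⟨s, hs, h⟩ := h
    have h3 : (S : Multiset (List ℰ)).Nodup := by
      have := s.nodup
      rwa [h] at this
    refine ⟨Multiset.coe_nodup.1 h3, fun w hw => hs ?_⟩
    rw [← Finset.mem_val, h]
    exact hw
  · rintro ⟨h1, h2⟩
    simp only [arrangements, Finset.mem_biUnion, Finset.mem_powerset, Multiset.mem_toFinset,
      Multiset.mem_lists_iff]
    exact ⟨⟨S, Multiset.coe_nodup.2 h1⟩, fun w hw => h2 w hw, rfl⟩

/-- The set `𝓕(E)` of all separations of the sentence `E` into patterns of `D`. -/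
def separations (D : Finset (List ℰ)) (E : List ℰ) : Finset (List (List ℰ)) :=
  (arrangements D).filter fun S => S.flatten = E

/-- The set of all sentences generated by the pattern set `D`. -/
def sentences (D : Finset (List ℰ)) : Finset (List ℰ) :=
  (arrangements D).image List.flatten

/-- The length of the longest sentence generated by `D` in which the event `e` does not occur. -/
def maxLengthAvoiding (D : Finset (List ℰ)) (e : ℰ) : ℕ :=
  ((sentences D).filter fun E => e ∉ E).sup List.length

/-- The events `e` such that the 1-gram `[e]` belongs to `D`. -/
def oneGrams (D : Finset (List ℰ)) : Set ℰ :=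
  {e | [e] ∈ D}

/-- The probability `P(S)` of the pattern sequence `S` when pattern `w` has probability `θ w`. -/
noncomputable def separationProb (D : Finset (List ℰ)) (θ : List ℰ → ℝ) (S : List (List ℰ)) : ℝ :=
  1 / (S.length.factorial : ℝ) * ∏ w ∈ D, if w ∈ S then θ w else 1 - θ w

/-- The probability `P(E)` of the event sentence `E`. -/
noncomputable def sentenceProb (D : Finset (List ℰ)) (θ : List ℰ → ℝ) (E : List ℰ) : ℝ :=
  ∑ S ∈ separations D E, separationProb D θ S

end Sentences

/-- The gap times of a sequence of event times, where `s` is the time of the preceding event. -/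
def gapTimes (s : ℝ) : List ℝ → List ℝ
  | [] => []
  | t :: ts => (t - s) :: gapTimes t ts

/-- The parameters `(𝓓, {θ_jw}, {λ_j}, π, κ)` of a latent theme dictionary model with `J` classes.
Only the values `θ j w` at patterns `w ∈ dict` are meaningful. -/
structure Params (ℰ : Type*) (J : ℕ) where
  dict : Finset (List ℰ)
  θ : Fin J → List ℰ → ℝ
  rate : Fin J → ℝ
  weight : Fin J → ℝ
  κ : ℝ

namespace Params

variable {ℰ : Type*} [DecidableEq ℰ] {J : ℕ}

/-- The pattern set `𝓓_j = {w : θ_jw ≠ 0}` of class `j`. -/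
noncomputable def classDict (M : Params ℰ J) (j : Fin J) : Finset (List ℰ) :=
  M.dict.filter fun w => M.θ j w ≠ 0

/-- The set `𝓞_j` of sentences generated by class `j`. -/
noncomputable def classSentences (M : Params ℰ J) (j : Fin J) : Finset (List ℰ) :=
  sentences (M.classDict j)

/-- The equivalence class `[j]` of all classes with the same intensity as `j`. -/
noncomputable def equivClass (M : Params ℰ J) (j : Fin J) : Finset (Fin J) :=
  Finset.univ.filter fun i => M.rate i = M.rate j

/-- The set `𝓞_[j]` of sentences generated by the equivalence class `[j]`. -/
noncomputable def equivClassSentences (M : Params ℰ J) (j : Fin J) : Finset (List ℰ) :=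
  (M.equivClass j).biUnion M.classSentences

/-- The set `𝓞` of all sentences generated by the model. -/
noncomputable def allSentences (M : Params ℰ J) : Finset (List ℰ) :=
  Finset.univ.biUnion M.classSentences

/-- The joint density of an event sentence and its event times given class `z`, where `s` is the time
of the last event before the sentence. The `u`-th entry of `x` is (`u`-th event, its time). -/
noncomputable def sentenceDensity (M : Params ℰ J) (z : Fin J) (s : ℝ) (x : List (ℰ × ℝ)) : ℝ :=
  sentenceProb M.dict (M.θ z) (x.map Prod.fst) *
    ((gapTimes s (x.map Prod.snd)).map
      (ProbabilityTheory.exponentialPDFReal (M.rate z))).prod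

/-- The density of a sequence of sentences given class `z` and given the number of sentences, where
`s` is the time of the last event before them. -/
noncomputable def classDensity (M : Params ℰ J) (z : Fin J) : ℝ → List (List (ℰ × ℝ)) → ℝ
  | _, [] => 1
  | s, x :: xs =>
    M.sentenceDensity z s x * M.classDensity z ((x.map Prod.snd).getLast?.getD s) xs

/-- The density `P(e_{1:N}, t_{1:N})` of an event process observed as a sequence of sentences:
`x` lists the sentences, each given as the list of its events with their times. -/
noncomputable def density (M : Params ℰ J) (x : List (List (ℰ × ℝ))) : ℝ :=
  M.κ ^ x.length * Real.exp (-M.κ) / (x.length.factorial : ℝ) *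
    ∑ z, M.weight z * M.classDensity z 0 x

/-- Assumption A1. -/
def A1 (M : Params ℰ J) : Prop :=
  ∀ (j : Fin J) (e : ℰ), ∀ E ∈ M.equivClassSentences j,
    (∃ E₁ ∈ M.classSentences j, E₁ <:+: E ∧ e ∉ E₁ ∧
      E₁.length = maxLengthAvoiding (M.classDict j) e) →
    E ∈ M.classSentences j

/-- Assumption A2: patterns of length at least two consist of distinct events. -/
def A2 (M : Params ℰ J) : Prop :=
  ∀ w ∈ M.dict, 2 ≤ w.length → w.Nodup

/-- The parameter space `𝔓`. -/
structure InSpace (M : Params ℰ J) : Prop where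
  pattern_ne_nil : ∀ w ∈ M.dict, w ≠ []
  a1 : M.A1
  a2 : M.A2
  θ_mem : ∀ j, ∀ w ∈ M.dict, M.θ j w ∈ Set.Icc (0 : ℝ) 1
  rate_pos : ∀ j, 0 < M.rate j
  weight_pos : ∀ j, 0 < M.weight j
  weight_sum : ∑ j, M.weight j = 1
  κ_pos : 0 < M.κ

/-- The matrix with entries `θ_{ie} / (1 - θ_{ie})`, with rows `e ∈ I` and columns `i ∈ [j]`. -/
noncomputable def tMatrix (M : Params ℰ J) (j : Fin J) (I : Finset ℰ) :
    Matrix I (M.equivClass j) ℝ :=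
  Matrix.of fun e i => M.θ i [(e : ℰ)] / (1 - M.θ i [(e : ℰ)])

/-- All entries of the `T`-matrix are defined and it has full column rank. -/
def TMatrixFullColumnRank (M : Params ℰ J) (j : Fin J) (I : Finset ℰ) : Prop :=
  (∀ e ∈ I, ∀ i ∈ M.equivClass j, M.θ i [e] ≠ 1) ∧
    (M.tMatrix j I).rank = (M.equivClass j).card

/-- Condition C1 (parts a and b, for one and the same partition). -/
def C1 (M : Params ℰ J) : Prop :=
  ∀ j : Fin J, 1 < (M.equivClass j).card →
    ∃ I : Fin 3 → Finset ℰ,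
      Pairwise (fun k l => Disjoint (I k) (I l)) ∧
      (⋃ k, (I k : Set ℰ)) = oneGrams M.dict ∧
      (∀ e : Fin 3 → ℰ, (∀ k, e k ∈ I k) →
        (∀ l k, l ≠ k → (separations M.dict [e l, e k]).card = 1) ∧
        (separations M.dict [e 0, e 1, e 2]).card = 1) ∧
      (∀ k, (M.equivClass j).card ≤ (I k).card) ∧
      ∀ k, M.TMatrixFullColumnRank j (I k)

/-- Condition C2 (parts a and b, for one and the same set of 1-grams). -/
def C2 (M : Params ℰ J) : Prop :=
  ∀ j : Fin J, 1 < (M.equivClass j).card → ∀ w ∈ M.dict, 2 ≤ w.length →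
    ∃ I : Finset ℰ,
      (I : Set ℰ) ⊆ oneGrams M.dict ∧
      (∀ e ∈ I, ∀ S ∈ separations M.dict (w ++ [e]), ∀ v ∈ S,
        v.length = w.length + 1 ∨ v.length = w.length → v = w) ∧
      (M.equivClass j).card ≤ I.card ∧
      M.TMatrixFullColumnRank j I

/-- The restricted parameter space `𝔓⁰`. -/
structure InRestrictedSpace (M : Params ℰ J) : Prop extends M.InSpace where
  c1 : M.C1
  c2 : M.C2

/-- The dictionary is the union of the pattern sets of the classes, and every class has a pattern. -/
structure NoIdle (M : Params ℰ J) : Prop where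
  dict_used : ∀ w ∈ M.dict, ∃ j, w ∈ M.classDict j
  class_used : ∀ j, (M.classDict j).Nonempty

/-- Identifiability of a parameter tuple within `𝔓`. -/
def IsIdentifiable (M : Params ℰ J) : Prop :=
  ∀ M' : Params ℰ J, M'.InSpace →
    (∀ x : List (List (ℰ × ℝ)), M'.density x = M.density x) →
    M'.allSentences = M.allSentences →
    M'.dict.card ≤ M.dict.card →
    M'.dict = M.dict ∧ M'.κ = M.κ ∧
      ∃ ρ : Equiv.Perm (Fin J), ∀ j,
        (∀ w ∈ M.dict, M'.θ (ρ j) w = M.θ j w) ∧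
        M'.rate (ρ j) = M.rate j ∧ M'.weight (ρ j) = M.weight j

end Params

end LatentTheme

/-! Evaluate the density on processes in which all events of each sentence occur at one time, after
an integer gap. Given the class, this is multiplicative over the sentences, hence a character of the
free monoid on pairs (sentence, gap), and the observed density is a mixture of such characters.
Distinct characters are linearly independent, so each character carries the same total weight in
both models (`sum_weight_eq_of_sum_mul_eq`).

A character determines the rate, by comparing two gaps, and the law of a sentence. This law
determines all pattern probabilities (`eq_of_sentenceProb_eq`). The shortest sentences of positive
probability are the concatenations of all orderings of the patterns of probability one, and a set of
words with distinct letters is recovered from these concatenations (`eq_of_concatSubset`). The other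
probabilities follow by an extremal argument: one chooses a shortest pattern on which two parameter
choices disagree, lexicographically largest among those of its length.

By C1, classes of equal rate differ on some 1-gram, so the classes of the first model have distinct
characters. Each has positive weight and so occurs in the second model, which has equally many
classes. This gives the permutation, and the bound on the dictionary sizes excludes extra patterns.
-/

namespace LatentTheme

/-! ### Combinatorics of words: recovering a set of words from its concatenations -/

section Words

variable {α : Type*} [DecidableEq α]

theorem eq_of_append_cons_eq {e : α} : ∀ {a a' b b' : List α},
    a ++ e :: b = a' ++ e :: b' → a.count e = a'.count e → a = a'
  | [], [], _, _, _, _ => rfl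
  | [], x :: a', b, b', h, hc => by
    simp only [List.nil_append, List.cons_append, List.cons.injEq] at h
    obtain ⟨rfl, -⟩ := h
    simp at hc
  | x :: a, [], b, b', h, hc => by
    simp only [List.nil_append, List.cons_append, List.cons.injEq] at h
    obtain ⟨rfl, -⟩ := h
    simp at hc
  | x :: a, y :: a', b, b', h, hc => by
    simp only [List.cons_append, List.cons.injEq] at h
    obtain ⟨rfl, h⟩ := h
    rw [List.count_cons, List.count_cons, Nat.add_right_cancel_iff] at hc
    rw [eq_of_append_cons_eq h hc]

theorem exists_split_of_lt_countP {β : Type*} (p : β → Bool) : ∀ (S : List β) (x : ℕ),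
    x < S.countP p → ∃ S₁ w S₂, S = S₁ ++ w :: S₂ ∧ p w ∧ S₁.countP p = x
  | [], x, h => by simp at h
  | v :: S, x, h => by
    by_cases hv : p v
    · rw [List.countP_cons_of_pos hv] at h
      cases x with
      | zero => exact ⟨[], v, S, rfl, hv, rfl⟩
      | succ x =>
        obtain ⟨S₁, w, S₂, rfl, hw, hc⟩ := exists_split_of_lt_countP p S x (by omega)
        exact ⟨v :: S₁, w, S₂, rfl, hw, by rw [List.countP_cons_of_pos hv, hc]⟩
    · rw [List.countP_cons_of_neg hv] at h
      obtain ⟨S₁, w, S₂, rfl, hw, hc⟩ := exists_split_of_lt_countP p S x h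
      exact ⟨v :: S₁, w, S₂, rfl, hw, by rw [List.countP_cons_of_neg hv, hc]⟩

theorem count_flatten_of_nodup (e : α) : ∀ S : List (List α), (∀ w ∈ S, w.Nodup) →
    S.flatten.count e = S.countP (e ∈ ·)
  | [], _ => rfl
  | v :: S, h => by
    have ih := count_flatten_of_nodup e S fun w hw => h w (List.mem_cons_of_mem _ hw)
    have hv : v.Nodup := h v List.mem_cons_self
    rw [List.flatten_cons, List.count_append, ih, List.countP_cons, add_comm]
    congr 1
    rw [hv.count]
    simp

/-- The total length of the words in which `e` does not occur. -/
def freeLength (e : α) (S : List (List α)) : ℕ :=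
  (S.filter (e ∉ ·)).flatten.length

theorem freeLength_perm {e : α} {S T : List (List α)} (h : S.Perm T) :
    freeLength e S = freeLength e T :=
  ((h.filter _).flatten).length_eq

theorem freeLength_append (e : α) (S T : List (List α)) :
    freeLength e (S ++ T) = freeLength e S + freeLength e T := by
  simp [freeLength]

/-- The equality case is the point: a tight length count forces every word containing `e` to have
the maximal length. -/
theorem length_flatten_le {e : α} {l : ℕ} : ∀ S : List (List α), (∀ w ∈ S, w.length ≤ l) →
    S.flatten.length ≤ S.countP (e ∈ ·) * l + freeLength e S ∧
      (S.countP (e ∈ ·) * l + freeLength e S ≤ S.flatten.length →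
        ∀ w ∈ S, e ∈ w → w.length = l)
  | [], _ => by simp [freeLength]
  | v :: S, h => by
    obtain ⟨h1, h2⟩ := length_flatten_le (e := e) S fun w hw => h w (List.mem_cons_of_mem _ hw)
    have hv := h v List.mem_cons_self
    rw [show v :: S = [v] ++ S from rfl, freeLength_append]
    by_cases hev : e ∈ v
    · have h3 : freeLength e [v] = 0 := by simp [freeLength, hev]
      simp only [List.singleton_append, List.countP_cons, hev, decide_true, if_true,
        List.flatten_cons, List.length_append, h3, add_mul, one_mul]
      refine ⟨by omega, fun h4 w hw hew => ?_⟩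
      rcases List.mem_cons.1 hw with rfl | hw
      · omega
      · exact h2 (by omega) w hw hew
    · have h3 : freeLength e [v] = v.length := by simp [freeLength, hev]
      simp only [List.singleton_append, List.countP_cons, hev, decide_false,
        List.flatten_cons, List.length_append, h3, Bool.false_eq_true, if_false, add_zero]
      refine ⟨by omega, fun h4 w hw hew => ?_⟩
      rcases List.mem_cons.1 hw with rfl | hw
      · exact absurd hew hev
      · exact h2 (by omega) w hw hew

/-- Reading from the left, a nonempty word that starts where a copy of `e :: y` starts begins with
`e`, so it has the length of that copy and equals it. -/
theorem le_count_of_flatten_eq {e : α} {y R : List α} (hR : e ∉ R) :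
    ∀ (S : List (List α)) (x : ℕ), (∀ w ∈ S, e ∈ w → w.length = (e :: y).length) →
      S.flatten = (List.replicate x (e :: y)).flatten ++ R → x ≤ S.count (e :: y)
  | _, 0, _, _ => Nat.zero_le _
  | [], x + 1, _, h => by simp [List.replicate_succ] at h
  | [] :: S, x + 1, hS, h => by
    have := le_count_of_flatten_eq hR S (x + 1)
      (fun w hw => hS w (List.mem_cons_of_mem _ hw)) (by simpa using h)
    exact this.trans (List.count_le_count_cons)
  | (a :: v) :: S, x + 1, hS, h => by
    rw [List.replicate_succ, List.flatten_cons, List.flatten_cons, List.append_assoc] at h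
    have ha : a = e := by simpa using congrArg List.head? h
    subst ha
    have hl := hS (a :: v) List.mem_cons_self List.mem_cons_self
    obtain ⟨h1, h2⟩ := List.append_inj h hl
    have := le_count_of_flatten_eq hR S x (fun w hw => hS w (List.mem_cons_of_mem _ hw)) h2
    rw [h1, List.count_cons_self]
    omega

/-- The number of letters of `w` before the first occurrence of `e`. -/
def prefixLength (e : α) (w : List α) : ℕ :=
  (w.takeWhile (· ≠ e)).length

theorem exists_eq_append_cons {e : α} {w : List α} (h : e ∈ w) :
    ∃ p s, w = p ++ e :: s ∧ e ∉ p ∧ p.length = prefixLength e w := by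
  induction w with
  | nil => simp at h
  | cons a w ih =>
    by_cases ha : a = e
    · subst ha
      exact ⟨[], w, rfl, by simp, by simp [prefixLength]⟩
    · obtain ⟨p, s, h1, h2, h3⟩ := ih (by simpa [Ne.symm ha] using h)
      refine ⟨a :: p, s, by rw [h1]; rfl, by simp [h2, Ne.symm ha], ?_⟩
      simp [prefixLength, ha, h3]

theorem not_mem_flatten_filter (e : α) (S : List (List α)) :
    e ∉ (S.filter (e ∉ ·)).flatten := by
  simp only [List.mem_flatten, List.mem_filter, not_exists, not_and]
  rintro w ⟨-, hw⟩
  simpa using hw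

/-- The position of an `e` is fixed by the number of earlier ones. Words of `S₁` contain `e` at most
once, so `x` counts the occurrences before `w`, and the displayed `e` is the one in `w`. -/
theorem flatten_eq_of_split {e : α} {S₁ S₂ : List (List α)} {w F G : List α} {x : ℕ}
    (hn : ∀ v ∈ S₁, v.Nodup) (hw : e ∈ w) (hx : S₁.countP (e ∈ ·) = x)
    (hF : F.count e = x) (h : (S₁ ++ w :: S₂).flatten = F ++ e :: G) :
    ∃ p, S₁.flatten ++ p = F ∧ e ∉ p ∧ p.length = prefixLength e w := by
  obtain ⟨p, s, rfl, hp, hl⟩ := exists_eq_append_cons hw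
  refine ⟨p, ?_, hp, hl⟩
  have h' : (S₁.flatten ++ p) ++ e :: (s ++ S₂.flatten) = F ++ e :: G := by
    rw [← h]; simp
  refine eq_of_append_cons_eq h' ?_
  rw [List.count_append, count_flatten_of_nodup e S₁ hn, hx, hF, List.count_eq_zero_of_not_mem hp]
  rfl

/-- Every concatenation of a rearrangement of `V` is one of a rearrangement of `V'`. -/
def ConcatSubset (V V' : List (List α)) : Prop :=
  ∀ S : List (List α), S.Perm V → ∃ S' : List (List α), S'.Perm V' ∧ S'.flatten = S.flatten

/-- Arrange `V'` with its `e`-free words first and `w'` next; the first `e` then stands at the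
position on the left. In the matching arrangement of `V`, only `e`-free words precede the word `w`
that holds this `e`. -/
theorem exists_prefixLength_le {e : α} {V V' : List (List α)} (hV : ∀ w ∈ V, w.Nodup)
    (h : ConcatSubset V' V)
    {w' : List α} (hw' : w' ∈ V') (he : e ∈ w') :
    ∃ w ∈ V, e ∈ w ∧ freeLength e V' + prefixLength e w' ≤ freeLength e V + prefixLength e w := by
  obtain ⟨p, s, hps, hp, hl⟩ := exists_eq_append_cons he
  have hmem : w' ∈ V'.filter (e ∈ ·) := by simp [hw', he]
  have hperm : (V'.filter (e ∉ ·) ++ w' :: (V'.filter (e ∈ ·)).erase w').Perm V' := by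
    refine ((List.perm_cons_erase hmem).symm.append_left _).trans ?_
    refine (List.perm_append_comm).trans ?_
    simpa using List.filter_append_perm (fun w => decide (e ∈ w)) V'
  obtain ⟨S, hS, hfl⟩ := h _ hperm
  set F := (V'.filter (e ∉ ·)).flatten ++ p with hF
  set G := s ++ ((V'.filter (e ∈ ·)).erase w').flatten with hG
  have hFG : S.flatten = F ++ e :: G := by
    rw [hfl, hF, hG]; simp [hps]
  have hF0 : F.count e = 0 := by
    rw [List.count_eq_zero, hF, List.mem_append, not_or]
    exact ⟨not_mem_flatten_filter e V', hp⟩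
  have hSn : ∀ w ∈ S, w.Nodup := fun w hw => hV w (hS.mem_iff.1 hw)
  have hpos : 0 < S.countP (e ∈ ·) := by
    rw [← count_flatten_of_nodup e S hSn, hFG]
    simp
  obtain ⟨S₁, w, S₂, hsp, hw, hc⟩ := exists_split_of_lt_countP _ S 0 hpos
  have hw : e ∈ w := by simpa using hw
  rw [hsp] at hFG
  obtain ⟨q, hq1, -, hq2⟩ := flatten_eq_of_split
    (fun v hv => hSn v (by rw [hsp]; simp [hv])) hw hc hF0 hFG
  refine ⟨w, hS.mem_iff.1 (by rw [hsp]; simp), hw, ?_⟩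
  have hlen := congrArg List.length hq1
  rw [hF, List.length_append, List.length_append, hl, hq2] at hlen
  have h1 : freeLength e S₁ ≤ freeLength e V := by
    rw [← freeLength_perm hS, hsp, freeLength_append]
    omega
  have h2 : S₁.flatten.length = freeLength e S₁ := by
    rw [freeLength, List.filter_eq_self.2]
    intro v hv
    rw [List.countP_eq_zero] at hc
    simpa using hc v hv
  have h3 : freeLength e V' = ((V'.filter (e ∉ ·)).flatten).length := rfl
  omega

/-- If two lists of words with distinct letters have the same set of concatenations of all their
rearrangements, a word that no other word exceeds in length occurs equally often in both. -/
theorem count_le_count_of_flatten {V V' : List (List α)} {u : List α} (hu : u ≠ [])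
    (hV : ∀ w ∈ V, w.Nodup) (hV' : ∀ w ∈ V', w.Nodup)
    (hl' : ∀ w ∈ V', w.length ≤ u.length)
    (h : ConcatSubset V V')
    (h' : ConcatSubset V' V) :
    V.count u ≤ V'.count u := by
  obtain ⟨e, y, rfl⟩ := List.exists_cons_of_ne_nil hu
  set u := e :: y with hu'
  set B := V.filter (e ∉ ·) with hB
  set A := V.filter (e ∈ ·) with hA
  set x := V.count u with hx
  have heu : e ∈ u := List.mem_cons_self
  have hAx : A.count u = x := by
    rw [hA, List.count_filter (by simpa using heu)]
  set C := A.filter (· ≠ u) with hC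
  have hA' : (List.replicate x u ++ C).Perm A := by
    have := List.filter_append_perm (· == u) A
    rw [List.filter_beq, hAx] at this
    refine List.Perm.trans (List.Perm.of_eq ?_) this
    congr 1
    rw [hC]
    congr 1
    ext w
    by_cases hw : w = u <;> simp [hw]
  have hAB : (A ++ B).Perm V := by
    simpa [hA, hB] using List.filter_append_perm (fun w => decide (e ∈ w)) V
  have hp0 : prefixLength e u = 0 := by simp [prefixLength, hu']
  have hreplen : (List.replicate x u).flatten.length = x * u.length := by simp
  have hrepcount : (List.replicate x u).flatten.count e = x * u.count e := by
    simp [List.count_flatten]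
  have hfB : B.flatten.length = freeLength e V := rfl
  have hnB : e ∉ B.flatten := not_mem_flatten_filter e V
  rcases Nat.eq_zero_or_pos x with hx0 | hxpos
  · omega
  have huV : u ∈ V := List.count_pos_iff.1 hxpos
  have hcu : u.count e = 1 := by rw [(hV u huV).count, if_pos heu]
  -- If `u` is the only word of `V` containing `e`, there is no later `e` to use as a marker, but
  -- `prefixLength e u = 0` makes the length count tight.
  by_cases hC0 : C = []
  · have hS : (List.replicate x u ++ B).Perm V := by
      rw [hC0, List.append_nil] at hA'
      exact (hA'.append_right B).trans hAB
    obtain ⟨S', hS', hfl⟩ := h _ hS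
    have hS'n : ∀ w ∈ S', w.Nodup := fun w hw => hV' w (hS'.mem_iff.1 hw)
    have hS'l : ∀ w ∈ S', w.length ≤ u.length := fun w hw => hl' w (hS'.mem_iff.1 hw)
    rw [List.flatten_append] at hfl
    have hcnt : S'.countP (e ∈ ·) = x := by
      rw [← count_flatten_of_nodup e S' hS'n, hfl, List.count_append, hrepcount, hcu,
        List.count_eq_zero_of_not_mem hnB]
      omega
    have hpos : 0 < S'.countP (e ∈ ·) := by omega
    obtain ⟨w', hw', hew'⟩ := List.countP_pos_iff.1 hpos
    have hew' : e ∈ w' := by simpa using hew'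
    obtain ⟨v, hv, hev, hle⟩ := exists_prefixLength_le hV h' (hS'.mem_iff.1 hw') hew'
    have hvu : v = u := by
      by_contra hne
      have : v ∈ C := by simp [hC, hA, hv, hev, hne]
      simp [hC0] at this
    rw [hvu, hp0] at hle
    have hlen := congrArg List.length hfl
    rw [List.length_append, hreplen, hfB] at hlen
    have hfull := (length_flatten_le (e := e) S' hS'l).2 (by
      rw [hcnt, freeLength_perm hS']; omega)
    rw [← hS'.count_eq]
    exact le_count_of_flatten_eq hnB S' x hfull hfl
  · obtain ⟨w, hwC, hmax⟩ : ∃ w ∈ C, ∀ v ∈ C, prefixLength e v ≤ prefixLength e w := by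
      obtain ⟨w, hw, hm⟩ := C.toFinset.exists_max_image (prefixLength e)
        (by simpa [Finset.nonempty_iff_ne_empty] using hC0)
      exact ⟨w, by simpa using hw, fun v hv => hm v (by simpa using hv)⟩
    have hwA : w ∈ A := (List.mem_filter.1 hwC).1
    have hew : e ∈ w := by simpa using (List.mem_filter.1 hwA).2
    obtain ⟨p, s, hps, hp, hpl⟩ := exists_eq_append_cons hew
    -- The `e` of `w` is preceded by exactly `x` others, and its position is as late as the choice
    -- of `w` allows.
    have hS : (List.replicate x u ++ B ++ w :: C.erase w).Perm V := by
      refine List.Perm.trans ?_ hAB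
      refine List.Perm.trans ?_ (hA'.append_right B)
      rw [List.append_assoc, List.append_assoc]
      refine List.Perm.append_left _ ?_
      exact ((List.perm_cons_erase hwC).symm.append_left _).trans List.perm_append_comm
    obtain ⟨S', hS', hfl⟩ := h _ hS
    have hS'n : ∀ w ∈ S', w.Nodup := fun w hw => hV' w (hS'.mem_iff.1 hw)
    have hS'l : ∀ w ∈ S', w.length ≤ u.length := fun w hw => hl' w (hS'.mem_iff.1 hw)
    set F := (List.replicate x u).flatten ++ (B.flatten ++ p) with hF
    set G := s ++ (C.erase w).flatten with hG
    have hFG : S'.flatten = F ++ e :: G := by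
      rw [hfl, hF, hG]
      simp only [List.flatten_append, List.flatten_cons, List.append_assoc]
      nth_rewrite 1 [hps]
      simp
    have hnBp : e ∉ B.flatten ++ p := by simpa using ⟨by simpa using hnB, hp⟩
    have hFx : F.count e = x := by
      rw [hF, List.count_append, hrepcount, hcu, List.count_eq_zero_of_not_mem hnBp]
      omega
    have hlt : x < S'.countP (e ∈ ·) := by
      rw [← count_flatten_of_nodup e S' hS'n, hFG, List.count_append, hFx]
      simp
    obtain ⟨S₁, w', S₂, hsp, hew', hc⟩ := exists_split_of_lt_countP _ S' x hlt
    have hew' : e ∈ w' := by simpa using hew'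
    rw [hsp] at hFG
    have hS₁ : ∀ v ∈ S₁, v ∈ S' := fun v hv => by rw [hsp]; simp [hv]
    obtain ⟨q, hq1, hq0, hq2⟩ := flatten_eq_of_split
      (fun v hv => hS'n v (hS₁ v hv)) hew' hc hFx hFG
    have hw' : w' ∈ V' := hS'.mem_iff.1 (by rw [hsp]; simp)
    obtain ⟨v, hv, hev, hle⟩ := exists_prefixLength_le hV h' hw' hew'
    have hvw : prefixLength e v ≤ prefixLength e w := by
      by_cases hvu : v = u
      · rw [hvu, hp0]; exact Nat.zero_le _
      · exact hmax v (by simp [hC, hA, hv, hev, hvu])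
    have hfree : freeLength e S₁ ≤ freeLength e V' := by
      rw [← freeLength_perm hS', hsp, freeLength_append]
      omega
    have hlen := congrArg List.length hq1
    rw [hF, List.length_append, List.length_append, List.length_append, hreplen, hfB, hpl, hq2]
      at hlen
    have hbd := length_flatten_le (e := e) S₁ fun v hv => hS'l v (hS₁ v hv)
    rw [hc] at hbd
    -- Before this `e`, the words of `S₁` and the prefix of `w'` have total length at most `x *
    -- u.length + freeLength e V' + prefixLength e w'`. By `hle` and `hvw` this is at most the
    -- actual position, so all these inequalities are equalities.
    have hfull := hbd.2 (by omega)
    obtain ⟨R, hR1, hR2⟩ : ∃ R, S₁.flatten = (List.replicate x u).flatten ++ R ∧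
        R ++ q = B.flatten ++ p := by
      rcases List.append_eq_append_iff.1 hq1 with ⟨a, h1, h2⟩ | ⟨a, h1, h2⟩
      · have : a = [] := by
          have := congrArg List.length h1
          rw [List.length_append, hreplen] at this
          exact List.length_eq_zero_iff.1 (by omega)
        subst this
        exact ⟨[], by simpa using h1.symm, by simpa using h2⟩
      · exact ⟨a, h1, h2.symm⟩
    have heR : e ∉ R := fun hR => hnBp (by rw [← hR2]; simp [hR])
    have : x ≤ S₁.count u := le_count_of_flatten_eq heR S₁ x hfull hR1
    rw [← hS'.count_eq, hsp, List.count_append]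
    omega

theorem exists_perm_map_eq {β γ : Type*} (f : β → γ) {l : List β} {S : List γ}
    (h : S.Perm (l.map f)) : ∃ l' : List β, l'.Perm l ∧ l'.map f = S := by
  have hf : List.Forall₂ (fun c b => c = f b) (l.map f) l := by
    rw [List.forall₂_map_left_iff]
    exact List.forall₂_same.2 fun _ _ => rfl
  obtain ⟨l', h1, h2⟩ := List.perm_comp_forall₂ h hf
  refine ⟨l', h2, ?_⟩
  clear h h2 hf
  induction h1 with
  | nil => rfl
  | cons h _ ih => rw [List.map_cons, ih, h]

/-- The words of a finite set that contain `u` as a scattered subword, when letters are distinct. -/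
def extensions (W : Finset (List α)) (u : List α) : Finset (List α) :=
  W.filter fun w => w.filter (· ∈ u) = u

/-- Deleting all letters outside `u` commutes with concatenation and leaves words no longer than
`u`. The extensions of `u` are the words that become `u`, so `count_le_count_of_flatten` applies to
the resulting multisets. -/
theorem card_extensions_le {W W' : Finset (List α)} (hW : ∀ w ∈ W, w.Nodup)
    (hW' : ∀ w ∈ W', w.Nodup)
    (h : ConcatSubset W.toList W'.toList)
    (h' : ConcatSubset W'.toList W.toList)
    {u : List α} (hu : u ≠ []) :
    (extensions W u).card ≤ (extensions W' u).card := by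
  set f : List α → List α := List.filter (· ∈ u) with hf
  have hcount : ∀ X : Finset (List α), (X.toList.map f).count u = (extensions X u).card := by
    intro X
    rw [List.count, List.countP_map, extensions, Finset.card, Finset.filter_val,
      ← Multiset.countP_eq_card_filter, ← Finset.coe_toList, Multiset.coe_countP]
    exact List.countP_congr fun w _ => by simp [hf]
  have transfer : ∀ {X X' : Finset (List α)},
      ConcatSubset X.toList X'.toList → ConcatSubset (X.toList.map f) (X'.toList.map f) := by
    intro X X' hX S hS
    obtain ⟨T, hT, rfl⟩ := exists_perm_map_eq f hS
    obtain ⟨T', hT', hfl⟩ := hX T hT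
    refine ⟨T'.map f, hT'.map f, ?_⟩
    rw [hf, ← List.filter_flatten, ← List.filter_flatten, hfl]
  have hnodup : ∀ {X : Finset (List α)}, (∀ w ∈ X, w.Nodup) →
      ∀ w ∈ X.toList.map f, w.Nodup ∧ w.length ≤ u.length := by
    intro X hX w hw
    obtain ⟨v, hv, rfl⟩ := List.mem_map.1 hw
    have hn : (f v).Nodup := (hX v (by simpa using hv)).filter _
    refine ⟨hn, (hn.subperm fun a ha => ?_).length_le⟩
    simpa using (List.mem_filter.1 ha).2
  rw [← hcount, ← hcount]
  exact count_le_count_of_flatten hu (fun w hw => (hnodup hW w hw).1)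
    (fun w hw => (hnodup hW' w hw).1) (fun w hw => (hnodup hW' w hw).2) (transfer h) (transfer h')

/-- A finite set of nonempty words with distinct letters is determined by the set of concatenations
of all arrangements of its elements. -/
theorem eq_of_concatSubset {W W' : Finset (List α)} (hW : ∀ w ∈ W, w.Nodup ∧ w ≠ [])
    (hW' : ∀ w ∈ W', w.Nodup ∧ w ≠ [])
    (h : ConcatSubset W.toList W'.toList)
    (h' : ConcatSubset W'.toList W.toList) :
    W = W' := by
  -- An extension of `u` other than `u` is strictly longer. If the sets agree on longer words, their
  -- extensions of `u` differ by `u` alone.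
  have main : ∀ {X X' : Finset (List α)} {u : List α}, u ∈ X → u ∉ X' →
      (∀ w, u.length < w.length → (w ∈ X ↔ w ∈ X')) →
      (extensions X' u).card < (extensions X u).card := by
    intro X X' u hu hu' hlong
    refine Finset.card_lt_card ⟨fun w hw => ?_, fun hsub => ?_⟩
    · rw [extensions, Finset.mem_filter] at hw ⊢
      refine ⟨(hlong w ?_).2 hw.1, hw.2⟩
      have hle : u.length ≤ w.length := by
        rw [← hw.2]
        exact List.length_filter_le _ _
      refine lt_of_le_of_ne hle fun heq => hu' ?_
      have : w.filter (· ∈ u) = w := by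
        refine (List.filter_sublist (l := w)).eq_of_length ?_
        rw [hw.2, heq]
      rw [← hw.2, this]
      exact hw.1
    · have : u ∈ extensions X u := by
        simp [extensions, hu]
      exact hu' (Finset.mem_filter.1 (hsub this)).1
  by_contra hne
  have hD : (symmDiff W W').Nonempty := by
    rw [Finset.nonempty_iff_ne_empty]
    simpa using hne
  obtain ⟨u, hu, hmax⟩ := Finset.exists_max_image _ List.length hD
  have hlong : ∀ w, u.length < w.length → (w ∈ W ↔ w ∈ W') := by
    intro w hw
    by_contra hc
    have : w ∈ symmDiff W W' := by
      rw [Finset.mem_symmDiff]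
      tauto
    exact absurd (hmax w this) (by omega)
  rcases Finset.mem_symmDiff.1 hu with ⟨h1, h2⟩ | ⟨h1, h2⟩
  · have := card_extensions_le (fun w hw => (hW w hw).1) (fun w hw => (hW' w hw).1) h h' (hW u h1).2
    exact absurd (main h1 h2 hlong) (by omega)
  · have := card_extensions_le (fun w hw => (hW' w hw).1) (fun w hw => (hW w hw).1) h' h (hW' u h1).2
    exact absurd (main h1 h2 fun w hw => (hlong w hw).symm) (by omega)

end Words

/-! ### The law of a sentence determines the pattern probabilities -/

section Injectivity

variable {α : Type*}

theorem append_lt_append_of_lt [LinearOrder α] (x y : List α) {w m : List α}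
    (hl : w.length = m.length) (h : w < m) : x ++ w ++ y < x ++ m ++ y := by
  induction x with
  | nil =>
    simp only [List.nil_append]
    induction w generalizing m with
    | nil =>
      have : m = [] := List.length_eq_zero_iff.1 hl.symm
      subst this
      exact absurd h (lt_irrefl _)
    | cons a w ih =>
      cases m with
      | nil => simp at hl
      | cons b m =>
        rw [List.cons_lt_cons_iff] at h
        rw [List.cons_append, List.cons_append, List.cons_lt_cons_iff]
        rcases h with h | ⟨h1, h2⟩
        · exact Or.inl h
        · exact Or.inr ⟨h1, ih (by simpa using hl) h2⟩
  | cons a x ih =>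
    rw [List.cons_append, List.cons_append, List.cons_append, List.cons_append,
      List.cons_lt_cons_iff]
    exact Or.inr ⟨rfl, ih⟩

theorem eq_nil_of_length_flatten_eq_zero {S : List (List α)} (hS : ∀ w ∈ S, w ≠ [])
    (h : S.flatten.length = 0) : S = [] := by
  cases S with
  | nil => rfl
  | cons w S =>
    rw [List.flatten_cons, List.length_append] at h
    exact absurd (List.length_eq_zero_iff.1 (by omega)) (hS w List.mem_cons_self)

/-- The patterns that are used with probability one. -/
noncomputable def certain (U : Finset (List α)) (θ : List α → ℝ) : Finset (List α) :=
  U.filter fun w => θ w = 1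

/-- The probability that no pattern outside `certain U θ` is used. -/
noncomputable def failProb (U : Finset (List α)) (θ : List α → ℝ) : ℝ :=
  ∏ w ∈ U.filter fun w => ¬ θ w = 1, (1 - θ w)

variable {U : Finset (List α)} {θ : List α → ℝ}

theorem failProb_pos (hθ : ∀ w ∈ U, θ w ∈ Set.Icc (0 : ℝ) 1) : 0 < failProb U θ := by
  refine Finset.prod_pos fun w hw => ?_
  rw [Finset.mem_filter] at hw
  have := lt_of_le_of_ne (hθ w hw.1).2 hw.2
  linarith

variable [DecidableEq α]

theorem mem_separations {U : Finset (List α)} {E : List α} {S : List (List α)} :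
    S ∈ separations U E ↔ (S.Nodup ∧ ∀ w ∈ S, w ∈ U) ∧ S.flatten = E := by
  rw [separations, Finset.mem_filter, mem_arrangements]

/-- The product of the odds of the patterns in `S` that are not certain. -/
noncomputable def oddsProd (U : Finset (List α)) (θ : List α → ℝ) (S : List (List α)) : ℝ :=
  ∏ w ∈ U.filter fun w => ¬ θ w = 1, if w ∈ S then θ w / (1 - θ w) else 1

theorem oddsProd_nonneg (hθ : ∀ w ∈ U, θ w ∈ Set.Icc (0 : ℝ) 1) (S : List (List α)) :
    0 ≤ oddsProd U θ S := by
  refine Finset.prod_nonneg fun w hw => ?_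
  have h := hθ w (Finset.mem_filter.1 hw).1
  split_ifs
  · exact div_nonneg h.1 (by linarith [h.2])
  · exact zero_le_one

/-- Odds are defined only for patterns of probability below one; omitting a certain pattern makes
the whole product vanish. -/
theorem separationProb_eq (U : Finset (List α)) (θ : List α → ℝ) (S : List (List α)) :
    separationProb U θ S =
      if ∀ w ∈ certain U θ, w ∈ S then failProb U θ * (oddsProd U θ S / S.length.factorial)
      else 0 := by
  rw [separationProb, ← Finset.prod_filter_mul_prod_filter_not U (fun w => θ w = 1)]
  split_ifs with h
  · have h1 : (∏ w ∈ U.filter fun w => θ w = 1, if w ∈ S then θ w else 1 - θ w) = 1 :=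
      Finset.prod_eq_one fun w hw => by
        rw [if_pos (h w hw)]
        exact (Finset.mem_filter.1 hw).2
    have h2 : (∏ w ∈ U.filter fun w => ¬ θ w = 1, if w ∈ S then θ w else 1 - θ w) =
        failProb U θ * oddsProd U θ S := by
      rw [failProb, oddsProd, ← Finset.prod_mul_distrib]
      refine Finset.prod_congr rfl fun w hw => ?_
      have : 1 - θ w ≠ 0 := sub_ne_zero.2 (Ne.symm (Finset.mem_filter.1 hw).2)
      split_ifs
      · rw [mul_div_cancel₀ _ this]
      · rw [mul_one]
    rw [h1, h2]
    ring
  · push Not at h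
    obtain ⟨w, hw, hwS⟩ := h
    have : (∏ w ∈ U.filter fun w => θ w = 1, if w ∈ S then θ w else 1 - θ w) = 0 := by
      refine Finset.prod_eq_zero hw ?_
      rw [if_neg hwS, (Finset.mem_filter.1 hw).2, sub_self]
    rw [this, zero_mul, mul_zero]

theorem sentenceProb_eq (U : Finset (List α)) (θ : List α → ℝ) (E : List α) :
    sentenceProb U θ E = failProb U θ *
      ∑ S ∈ (separations U E).filter fun S => ∀ w ∈ certain U θ, w ∈ S,
        oddsProd U θ S / S.length.factorial := by
  rw [sentenceProb, Finset.mul_sum, Finset.sum_filter]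
  exact Finset.sum_congr rfl fun S _ => separationProb_eq U θ S

theorem perm_append_filter_of_forall_mem {W : Finset (List α)} {S : List (List α)} (hS : S.Nodup)
    (hW : ∀ w ∈ W, w ∈ S) : S.Perm (W.toList ++ S.filter (· ∉ W)) := by
  have h1 : (S.filter (· ∈ W)).Perm W.toList := by
    rw [List.perm_ext_iff_of_nodup (hS.filter _) W.nodup_toList]
    intro w
    simpa using fun hw => hW w hw
  have h2 := List.filter_append_perm (fun w => decide (w ∈ W)) S
  refine h2.symm.trans ?_
  simpa using h1.append_right (S.filter (· ∉ W))

theorem perm_toList_of_length_eq {W : Finset (List α)} (hU : ∀ w ∈ U, w ≠ []) {E : List α}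
    {S : List (List α)} (hS : S ∈ separations U E) (hW : ∀ w ∈ W, w ∈ S)
    (hE : E.length = W.toList.flatten.length) : S.Perm W.toList := by
  obtain ⟨⟨hn, hm⟩, rfl⟩ := mem_separations.1 hS
  have h := perm_append_filter_of_forall_mem hn hW
  have hl := h.flatten.length_eq
  rw [List.flatten_append, List.length_append] at hl
  rw [eq_nil_of_length_flatten_eq_zero
    (fun w hw => hU w (hm w (List.mem_filter.1 hw).1)) (by omega), List.append_nil] at h
  exact h

theorem mem_separations_of_perm {W : Finset (List α)} (hW : W ⊆ U) {S : List (List α)}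
    (hS : S.Perm W.toList) : S ∈ separations U S.flatten ∧ ∀ w ∈ W, w ∈ S := by
  refine ⟨mem_separations.2 ⟨⟨hS.nodup_iff.2 W.nodup_toList, fun w hw => ?_⟩, rfl⟩, fun w hw => ?_⟩
  · exact hW (by simpa using hS.mem_iff.1 hw)
  · exact hS.mem_iff.2 (by simpa using hw)

theorem oddsProd_of_perm_certain {S : List (List α)} (hS : S.Perm (certain U θ).toList) :
    oddsProd U θ S = 1 := by
  refine Finset.prod_eq_one fun w hw => if_neg fun hwS => ?_
  have : w ∈ certain U θ := by simpa using hS.mem_iff.1 hwS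
  exact (Finset.mem_filter.1 hw).2 (Finset.mem_filter.1 this).2

theorem sentenceProb_pos_of_perm_certain (hθ : ∀ w ∈ U, θ w ∈ Set.Icc (0 : ℝ) 1)
    {S : List (List α)} (hS : S.Perm (certain U θ).toList) : 0 < sentenceProb U θ S.flatten := by
  rw [sentenceProb_eq]
  refine mul_pos (failProb_pos hθ) ?_
  refine Finset.sum_pos' (fun T _ => div_nonneg (oddsProd_nonneg hθ T) (Nat.cast_nonneg _))
    ⟨S, Finset.mem_filter.2 (mem_separations_of_perm (Finset.filter_subset _ _) hS), ?_⟩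
  rw [oddsProd_of_perm_certain hS]
  exact div_pos one_pos (Nat.cast_pos.2 (Nat.factorial_pos _))

/-- A separation of nonzero probability uses every certain pattern; at the minimal length no room is
left for another nonempty one. -/
theorem le_length_of_sentenceProb_ne_zero (hU : ∀ w ∈ U, w ≠ []) {E : List α}
    (hE : sentenceProb U θ E ≠ 0) :
    (certain U θ).toList.flatten.length ≤ E.length ∧
      (E.length = (certain U θ).toList.flatten.length →
        ∃ S : List (List α), S.Perm (certain U θ).toList ∧ S.flatten = E) := by
  rw [sentenceProb_eq] at hE
  obtain ⟨S, hS, -⟩ := Finset.exists_ne_zero_of_sum_ne_zero (right_ne_zero_of_mul hE)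
  obtain ⟨hS, hW⟩ := Finset.mem_filter.1 hS
  have hS' := mem_separations.1 hS
  refine ⟨?_, fun hl => ⟨S, perm_toList_of_length_eq hU hS hW hl, hS'.2⟩⟩
  have hl := (perm_append_filter_of_forall_mem hS'.1.1 hW).flatten.length_eq
  rw [List.flatten_append, List.length_append, hS'.2] at hl
  omega

variable {θ' : List α → ℝ}

theorem certain_eq_of_sentenceProb_eq (hU : ∀ w ∈ U, w.Nodup ∧ w ≠ [])
    (hθ : ∀ w ∈ U, θ w ∈ Set.Icc (0 : ℝ) 1) (hθ' : ∀ w ∈ U, θ' w ∈ Set.Icc (0 : ℝ) 1)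
    (h : ∀ E, sentenceProb U θ E = sentenceProb U θ' E) : certain U θ = certain U θ' := by
  have hU0 : ∀ w ∈ U, w ≠ [] := fun w hw => (hU w hw).2
  have hlen : (certain U θ).toList.flatten.length = (certain U θ').toList.flatten.length := by
    refine le_antisymm ?_ ?_
    · refine (le_length_of_sentenceProb_ne_zero hU0 ?_).1
      rw [h]
      exact (sentenceProb_pos_of_perm_certain hθ' (List.Perm.refl _)).ne'
    · refine (le_length_of_sentenceProb_ne_zero hU0 ?_).1
      rw [← h]
      exact (sentenceProb_pos_of_perm_certain hθ (List.Perm.refl _)).ne'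
  refine eq_of_concatSubset (fun w hw => hU w (Finset.mem_filter.1 hw).1)
    (fun w hw => hU w (Finset.mem_filter.1 hw).1) (fun S hS => ?_) (fun S hS => ?_)
  · have h1 := (sentenceProb_pos_of_perm_certain hθ hS).ne'
    rw [h] at h1
    exact (le_length_of_sentenceProb_ne_zero hU0 h1).2 (hS.flatten.length_eq.trans hlen)
  · have h1 := (sentenceProb_pos_of_perm_certain hθ' hS).ne'
    rw [← h] at h1
    exact (le_length_of_sentenceProb_ne_zero hU0 h1).2 (hS.flatten.length_eq.trans hlen.symm)

/-- For a shortest possible sentence all odds products are one, so its probability is `failProb`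
times a positive factor depending only on the certain set. -/
theorem failProb_eq_of_sentenceProb_eq (hU : ∀ w ∈ U, w ≠ [])
    (hθ : ∀ w ∈ U, θ w ∈ Set.Icc (0 : ℝ) 1) (hW : certain U θ = certain U θ')
    (h : ∀ E, sentenceProb U θ E = sentenceProb U θ' E) : failProb U θ = failProb U θ' := by
  have hE := h (certain U θ).toList.flatten
  have hpos := sentenceProb_pos_of_perm_certain hθ (List.Perm.refl (certain U θ).toList)
  rw [sentenceProb_eq] at hpos
  rw [sentenceProb_eq, sentenceProb_eq, ← hW] at hE
  have hsum : ∀ S ∈ (separations U (certain U θ).toList.flatten).filter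
      fun S => ∀ w ∈ certain U θ, w ∈ S, oddsProd U θ' S / S.length.factorial =
        oddsProd U θ S / S.length.factorial := by
    intro S hS
    obtain ⟨hS, hSW⟩ := Finset.mem_filter.1 hS
    have hp := perm_toList_of_length_eq hU hS hSW rfl
    rw [oddsProd_of_perm_certain hp, oddsProd_of_perm_certain (hW ▸ hp)]
  rw [Finset.sum_congr rfl hsum] at hE
  exact mul_right_cancel₀ (right_ne_zero_of_mul hpos.ne') hE

/-- The probabilities of the patterns are determined by the distribution of the sentence. -/
theorem eq_of_sentenceProb_eq (hU : ∀ w ∈ U, w.Nodup ∧ w ≠ [])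
    (hθ : ∀ w ∈ U, θ w ∈ Set.Icc (0 : ℝ) 1) (hθ' : ∀ w ∈ U, θ' w ∈ Set.Icc (0 : ℝ) 1)
    (h : ∀ E, sentenceProb U θ E = sentenceProb U θ' E) : ∀ w ∈ U, θ w = θ' w := by
  have hU0 : ∀ w ∈ U, w ≠ [] := fun w hw => (hU w hw).2
  have hW := certain_eq_of_sentenceProb_eq hU hθ hθ' h
  have hc := failProb_eq_of_sentenceProb_eq hU0 hθ hW h
  set W := certain U θ with hWdef
  have hone : ∀ w ∈ U, θ w = 1 ↔ θ' w = 1 := by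
    intro w hw
    have : w ∈ certain U θ ↔ w ∈ certain U θ' := by rw [← hW]
    simpa [certain, hw] using this
  by_contra hne
  push Not at hne
  set bad := U.filter fun w => θ w ≠ θ' w with hbad
  have hbadne : bad.Nonempty := by
    obtain ⟨w, hw, hne⟩ := hne
    exact ⟨w, Finset.mem_filter.2 ⟨hw, hne⟩⟩
  have hbadW : ∀ w ∈ bad, w ∉ W := by
    intro w hw hwW
    rw [hbad, Finset.mem_filter] at hw
    have h1 := (Finset.mem_filter.1 hwW).2
    exact hw.2 (h1.trans ((hone w hw.1).1 h1).symm)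
  obtain ⟨w₀, hw₀, hmin⟩ := Finset.exists_min_image bad List.length hbadne
  -- Any linear order on events serves; it is used only to compare words lexicographically.
  let _ : LinearOrder α := by
    classical exact linearOrderOfSTO (WellOrderingRel (α := α))
  obtain ⟨m, hm, hmax⟩ := Finset.exists_max_image
    (bad.filter fun w => w.length = w₀.length) id ⟨w₀, by simp [hw₀]⟩
  obtain ⟨hm, hml⟩ := Finset.mem_filter.1 hm
  have hmU : m ∈ U := (Finset.mem_filter.1 hm).1
  have hmne : θ m ≠ θ' m := (Finset.mem_filter.1 hm).2
  have hmW := hbadW m hm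
  have hins : (m :: W.toList).Perm (insert m W).toList := (Finset.toList_insert hmW).symm
  -- `T` orders `m` and the certain patterns so that the concatenation is lexicographically largest.
  obtain ⟨T, hT, hTmax⟩ := Finset.exists_max_image
    (m :: W.toList).permutations.toFinset List.flatten
    ⟨m :: W.toList, by simp⟩
  have hT : T.Perm (m :: W.toList) := by simpa using hT
  have hTmax : ∀ S : List (List α), S.Perm (m :: W.toList) → S.flatten ≤ T.flatten :=
    fun S hS => hTmax S (by simpa using hS)
  set E := T.flatten with hEdef
  have hElen : E.length = m.length + W.toList.flatten.length := by
    rw [hEdef, hT.flatten.length_eq, List.flatten_cons, List.length_append]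
  set 𝓢 := (separations U E).filter fun S => ∀ w ∈ W, w ∈ S with h𝓢
  have hdiff : ∑ S ∈ 𝓢, (oddsProd U θ S - oddsProd U θ' S) / S.length.factorial = 0 := by
    have hE := h E
    rw [sentenceProb_eq, sentenceProb_eq, ← hc, ← hWdef, ← hW] at hE
    have := mul_left_cancel₀ (failProb_pos hθ).ne' hE
    simp only [sub_div, Finset.sum_sub_distrib]
    rw [sub_eq_zero]
    exact this
  have hodds_perm : ∀ (S : List (List α)), S.Perm (m :: W.toList) → ∀ φ : List α → ℝ,
      certain U φ = W → oddsProd U φ S = φ m / (1 - φ m) := by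
    intro S hS φ hφ
    rw [oddsProd, Finset.prod_eq_single m]
    · rw [if_pos (hS.mem_iff.2 List.mem_cons_self)]
    · intro w hw hwm
      refine if_neg fun hwS => ?_
      have : w ∈ W := by simpa [hwm] using hS.mem_iff.1 hwS
      rw [← hφ] at this
      exact (Finset.mem_filter.1 hw).2 (Finset.mem_filter.1 this).2
    · intro hmf
      refine absurd (Finset.mem_filter.2 ⟨hmU, fun h1 => hmW ?_⟩) hmf
      rw [← hφ]
      exact Finset.mem_filter.2 ⟨hmU, h1⟩
  -- A separation with a bad pattern `w` consists, by length, of `w` and the certain patterns, with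
  -- `w` as long as `m`. If `w < m`, replacing `w` by `m` would give a larger concatenation than
  -- `E`. Hence `w = m`; separations without bad patterns cancel.
  have hterm : ∀ S ∈ 𝓢, (oddsProd U θ S - oddsProd U θ' S) / S.length.factorial =
      if m ∈ S then (θ m / (1 - θ m) - θ' m / (1 - θ' m)) / (W.card + 1).factorial else 0 := by
    intro S hS
    obtain ⟨hS, hSW⟩ := Finset.mem_filter.1 hS
    obtain ⟨⟨hSn, hSU⟩, hSE⟩ := mem_separations.1 hS
    have hperm := perm_append_filter_of_forall_mem hSn hSW
    have hlen := hperm.flatten.length_eq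
    rw [hSE, hElen, List.flatten_append, List.length_append] at hlen
    by_cases hex : ∃ w ∈ S, w ∈ bad
    · obtain ⟨w, hwS, hwb⟩ := hex
      have hwW := hbadW w hwb
      have hwl : m.length ≤ w.length := hml ▸ hmin w hwb
      have hwf : w ∈ S.filter (· ∉ W) := by simp [hwS, hwW]
      have hp2 := List.perm_cons_erase hwf
      have hl2 := hp2.flatten.length_eq
      rw [List.flatten_cons, List.length_append] at hl2
      have hnil : (S.filter (· ∉ W)).erase w = [] := by
        refine eq_nil_of_length_flatten_eq_zero (fun v hv => ?_) (by omega)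
        exact hU0 v (hSU v (List.mem_filter.1 (List.mem_of_mem_erase hv)).1)
      rw [hnil] at hp2 hl2
      have hpw : S.Perm (w :: W.toList) :=
        hperm.trans ((hp2.append_left _).trans List.perm_append_comm)
      have hwl' : w.length = m.length := by
        simp only [List.flatten_nil, List.length_nil] at hl2
        omega
      have hle : w ≤ m := hmax w (Finset.mem_filter.2 ⟨hwb, hwl'.trans hml⟩)
      have hwm : w = m := by
        by_contra hwm
        have hlt := lt_of_le_of_ne hle hwm
        obtain ⟨S₁, S₂, rfl⟩ := List.append_of_mem hwS
        have h1 : (S₁ ++ m :: S₂).Perm (m :: W.toList) := by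
          refine List.perm_middle.trans (List.Perm.cons _ ?_)
          exact (List.perm_middle.symm.trans hpw).cons_inv
        have h2 := hTmax _ h1
        have h3 := append_lt_append_of_lt S₁.flatten S₂.flatten hwl' hlt
        rw [← hSE] at h2
        simp only [List.flatten_append, List.flatten_cons, ← List.append_assoc] at h2
        exact absurd h2 (not_le.2 h3)
      subst hwm
      rw [if_pos hwS, hodds_perm S hpw θ rfl, hodds_perm S hpw θ' hW.symm, hpw.length_eq,
        List.length_cons, Finset.length_toList]
    · push Not at hex
      rw [if_neg fun hmS => hex m hmS hm]
      have : oddsProd U θ S = oddsProd U θ' S := by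
        rw [oddsProd, oddsProd]
        refine Finset.prod_congr (Finset.filter_congr fun w hw => not_congr (hone w hw))
          fun w hw => ?_
        split_ifs with hwS
        · have : θ w = θ' w := by
            by_contra hne
            exact hex w hwS (Finset.mem_filter.2 ⟨(Finset.mem_filter.1 hw).1, hne⟩)
          rw [this]
        · rfl
      rw [this, sub_self, zero_div]
  rw [Finset.sum_congr rfl hterm, ← Finset.sum_filter, Finset.sum_const, nsmul_eq_mul] at hdiff
  have hTmem : T ∈ 𝓢.filter fun S => m ∈ S := by
    have h1 := mem_separations_of_perm (U := U) (W := insert m W)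
      (Finset.insert_subset hmU (Finset.filter_subset _ _)) (hT.trans hins)
    refine Finset.mem_filter.2 ⟨Finset.mem_filter.2 ⟨h1.1, fun w hw => ?_⟩, ?_⟩
    · exact h1.2 w (Finset.mem_insert_of_mem hw)
    · exact h1.2 m (Finset.mem_insert_self _ _)
  -- All surviving terms are equal and `T` is one of them, so the odds of `m` agree.
  have hcard : (((𝓢.filter fun S => m ∈ S).card : ℕ) : ℝ) ≠ 0 := by
    rw [Nat.cast_ne_zero]
    exact Finset.card_ne_zero_of_mem hTmem
  have h1 : θ m ≠ 1 := fun h1 => hmW (Finset.mem_filter.2 ⟨hmU, h1⟩)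
  have h1' : θ' m ≠ 1 := fun h1' => h1 ((hone m hmU).2 h1')
  have hodds := (mul_eq_zero.1 hdiff).resolve_left hcard
  rw [div_eq_zero_iff, or_iff_left (Nat.cast_ne_zero.2 (Nat.factorial_ne_zero _)), sub_eq_zero,
    div_eq_div_iff (sub_ne_zero.2 (Ne.symm h1)) (sub_ne_zero.2 (Ne.symm h1'))] at hodds
  exact hmne (by linarith)

/-- Patterns of probability zero can be dropped from the dictionary. -/
theorem sentenceProb_eq_of_subset {D U : Finset (List α)} (hD : D ⊆ U) (θ : List α → ℝ)
    (E : List α) :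
    sentenceProb U (fun w => if w ∈ D then θ w else 0) E = sentenceProb D θ E := by
  have hsub : separations D E ⊆ separations U E := by
    intro S hS
    rw [mem_separations] at hS ⊢
    exact ⟨⟨hS.1.1, fun w hw => hD (hS.1.2 w hw)⟩, hS.2⟩
  rw [sentenceProb, sentenceProb, ← Finset.sum_subset hsub]
  · refine Finset.sum_congr rfl fun S hS => ?_
    rw [mem_separations] at hS
    rw [separationProb, separationProb, ← Finset.prod_subset hD]
    · congr 1
      exact Finset.prod_congr rfl fun w hw => by simp [hw]
    · intro w _ hw
      have : w ∉ S := fun hwS => hw (hS.1.2 w hwS)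
      simp [this, hw]
  · intro S hS hS'
    rw [mem_separations] at hS hS'
    have : ∃ w ∈ S, w ∉ D := by
      by_contra hc
      push Not at hc
      exact hS' ⟨⟨hS.1.1, hc⟩, hS.2⟩
    obtain ⟨w, hwS, hwD⟩ := this
    rw [separationProb, Finset.prod_eq_zero (hS.1.2 w hwS), mul_zero]
    simp [hwS, hwD]

end Injectivity

/-! ### Linear independence of characters -/

section Mixtures

open Classical in
/-- The weights of a finite mixture of multiplicative functions are determined by the mixture. -/
theorem sum_weight_eq_of_sum_mul_eq {G ι : Type*} [Monoid G] [Fintype ι] {a a' : ι → ℝ}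
    {χ χ' : ι → G →* ℝ} (h : ∀ g, ∑ i, a i * χ i g = ∑ i, a' i * χ' i g) (φ : G →* ℝ) :
    ∑ i with χ i = φ, a i = ∑ i with χ' i = φ, a' i := by
  set s : Finset (G →* ℝ) := Finset.univ.image χ ∪ Finset.univ.image χ' with hs
  by_cases hφ : φ ∈ s
  · refine sub_eq_zero.1 (linearIndependent_iff'.1 (linearIndependent_monoidHom G ℝ) s
      (fun ψ => ∑ i with χ i = ψ, a i - ∑ i with χ' i = ψ, a' i) ?_ φ hφ)
    funext g
    have key : ∀ (b : ι → ℝ) (ξ : ι → G →* ℝ), (∀ i, ξ i ∈ s) →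
        ∑ ψ ∈ s, (∑ i with ξ i = ψ, b i) * ψ g = ∑ i, b i * ξ i g := by
      intro b ξ hξ
      rw [← Finset.sum_fiberwise_of_maps_to (fun i _ => hξ i)]
      refine Finset.sum_congr rfl fun ψ _ => ?_
      rw [Finset.sum_mul]
      exact Finset.sum_congr rfl fun i hi => by rw [(Finset.mem_filter.1 hi).2]
    simp only [Finset.sum_apply, Pi.smul_apply, smul_eq_mul, sub_mul, Finset.sum_sub_distrib,
      Pi.zero_apply]
    rw [key a χ fun i => by simp [hs], key a' χ' fun i => by simp [hs], h g, sub_self]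
  · have h1 : ∀ i, χ i ≠ φ := fun i hi => hφ (by simp [hs, ← hi])
    have h2 : ∀ i, χ' i ≠ φ := fun i hi => hφ (by simp [hs, ← hi])
    simp [h1, h2]

end Mixtures

/-! ### From the density to characters of a free monoid -/

theorem gapTimes_replicate (c : ℝ) : ∀ n : ℕ,
    gapTimes c (List.replicate n c) = List.replicate n 0
  | 0 => rfl
  | n + 1 => by
    rw [List.replicate_succ, gapTimes, gapTimes_replicate c n, sub_self, List.replicate_succ]

theorem exponentialPDFReal_of_nonneg {r x : ℝ} (hx : 0 ≤ x) :
    ProbabilityTheory.exponentialPDFReal r x = r * Real.exp (-(r * x)) := by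
  simp [ProbabilityTheory.exponentialPDFReal, ProbabilityTheory.gammaPDFReal, hx]

namespace Params

variable {ℰ : Type*} {J : ℕ}

/-- Full column rank makes the columns linearly independent, in particular distinct. -/
theorem exists_tMatrix_col_ne {M : Params ℰ J} {j i₁ i₂ : Fin J} {I : Finset ℰ}
    (hT : M.TMatrixFullColumnRank j I) (h₁ : i₁ ∈ M.equivClass j) (h₂ : i₂ ∈ M.equivClass j)
    (hne : i₁ ≠ i₂) : ∃ e ∈ I, M.θ i₁ [e] ≠ M.θ i₂ [e] := by
  by_contra hc
  push Not at hc
  have hli : LinearIndependent ℝ (M.tMatrix j I).col := by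
    rw [linearIndependent_iff_card_eq_finrank_span, Set.finrank, ← Matrix.rank_eq_finrank_span_cols,
      hT.2, Fintype.card_coe]
  have hcol : (M.tMatrix j I).col ⟨i₁, h₁⟩ = (M.tMatrix j I).col ⟨i₂, h₂⟩ := by
    funext e
    simp [tMatrix, Matrix.col, hc e e.2]
  exact hne (by simpa using hli.injective hcol)

variable [DecidableEq ℰ]

/-- The sentences `E` of the pairs `(E, t)` as an event process after time `s`: all events of `E`
occur simultaneously, with a gap `t` before them. -/
def simultaneousProcess : ℝ → List (List ℰ × ℕ) → List (List (ℰ × ℝ))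
  | _, [] => []
  | s, (E, t) :: gs => E.map (fun e => (e, s + t)) ::
      simultaneousProcess (if E = [] then s else s + t) gs

/-- The conditional density given class `z` of the processes `simultaneousProcess`, as a
multiplicative function. -/
noncomputable def character (M : Params ℰ J) (z : Fin J) : FreeMonoid (List ℰ × ℕ) →* ℝ :=
  FreeMonoid.lift fun g => sentenceProb M.dict (M.θ z) g.1 *
    (M.rate z ^ g.1.length * if g.1 = [] then 1 else Real.exp (-(M.rate z * g.2)))

/-- In a nonempty sentence only the first gap can be nonzero, and it is `t` whatever the clock `s`;
the remaining gaps each contribute a factor equal to the rate. An empty sentence has no gap and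
leaves the clock unchanged. -/
theorem classDensity_simultaneousProcess (M : Params ℰ J) (z : Fin J) :
    ∀ (s : ℝ) (gs : List (List ℰ × ℕ)),
      M.classDensity z s (simultaneousProcess s gs) = M.character z (FreeMonoid.ofList gs)
  | _, [] => by
    rw [simultaneousProcess, classDensity, FreeMonoid.ofList_nil, map_one]
  | s, (E, t) :: gs => by
    have hc : M.character z (FreeMonoid.ofList ((E, t) :: gs)) =
        sentenceProb M.dict (M.θ z) E *
          (M.rate z ^ E.length * if E = [] then 1 else Real.exp (-(M.rate z * t))) *
        M.character z (FreeMonoid.ofList gs) := by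
      rw [FreeMonoid.ofList_cons, map_mul]
      simp [character]
    have hfst : (E.map fun e => (e, s + (t : ℝ))).map Prod.fst = E := by
      rw [List.map_map]
      exact List.map_id E
    have hsnd : (E.map fun e => (e, s + (t : ℝ))).map Prod.snd =
        List.replicate E.length (s + (t : ℝ)) := by
      rw [List.map_map]
      exact List.map_const' ..
    rw [simultaneousProcess, classDensity, sentenceDensity, hfst, hsnd, hc]
    cases E with
    | nil => simp [gapTimes, classDensity_simultaneousProcess M z s gs]
    | cons e E =>
      have ht : (0 : ℝ) ≤ t := Nat.cast_nonneg t
      have hlast : (List.replicate (e :: E).length (s + (t : ℝ))).getLast?.getD s = s + t := by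
        simp [List.getLast?_replicate]
      rw [hlast, if_neg (List.cons_ne_nil _ _), if_neg (List.cons_ne_nil _ _),
        classDensity_simultaneousProcess M z (s + t) gs, List.length_cons, List.replicate_succ,
        gapTimes, gapTimes_replicate, add_sub_cancel_left, List.map_cons, List.prod_cons,
        List.map_replicate, List.prod_replicate, exponentialPDFReal_of_nonneg ht,
        exponentialPDFReal_of_nonneg le_rfl, mul_zero, neg_zero, Real.exp_zero, mul_one, pow_succ]
      ring

theorem density_nil (M : Params ℰ J) (hM : M.InSpace) : M.density [] = Real.exp (-M.κ) := by
  simp [density, classDensity, hM.weight_sum]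

theorem κ_eq_of_density_eq {M M' : Params ℰ J} (hM : M.InSpace) (hM' : M'.InSpace)
    (h : ∀ x, M'.density x = M.density x) : M'.κ = M.κ := by
  have h0 := h []
  rw [density_nil M hM, density_nil M' hM'] at h0
  simpa using Real.exp_injective h0

theorem sum_weight_mul_character_eq {M M' : Params ℰ J} (hM : M.InSpace) (hM' : M'.InSpace)
    (h : ∀ x, M'.density x = M.density x) (g : FreeMonoid (List ℰ × ℕ)) :
    ∑ z, M'.weight z * M'.character z g = ∑ z, M.weight z * M.character z g := by
  have hx := h (simultaneousProcess 0 (FreeMonoid.toList g))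
  rw [density, density, κ_eq_of_density_eq hM hM' h] at hx
  simp only [classDensity_simultaneousProcess, FreeMonoid.ofList_toList] at hx
  refine mul_left_cancel₀ ?_ hx
  have := pow_pos hM.κ_pos (simultaneousProcess 0 (FreeMonoid.toList g)).length
  positivity

theorem exists_sentenceProb_ne_zero {M : Params ℰ J} (hM : M.InSpace) {z : Fin J}
    (hz : (M.classDict z).Nonempty) : ∃ E, E ≠ [] ∧ sentenceProb M.dict (M.θ z) E ≠ 0 := by
  -- Using every pattern of the class once leaves out only patterns of probability zero, so all
  -- factors are positive.
  set S := (M.classDict z).toList with hS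
  have hmem : ∀ w, w ∈ S ↔ w ∈ M.dict ∧ M.θ z w ≠ 0 := fun w => by simp [hS, classDict]
  refine ⟨S.flatten, ?_, ?_⟩
  · intro h
    obtain ⟨w, hw⟩ := hz
    have hw : w ∈ S := by simpa [hS] using hw
    exact hM.pattern_ne_nil w ((hmem w).1 hw).1 (List.flatten_eq_nil_iff.1 h w hw)
  · have hfac : ∀ T : List (List ℰ), ∀ w ∈ M.dict, 0 ≤ if w ∈ T then M.θ z w else 1 - M.θ z w := by
      intro T w hw
      have := hM.θ_mem z w hw
      split_ifs
      · exact this.1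
      · linarith [this.2]
    refine (Finset.sum_pos' (fun T _ => ?_) ⟨S, mem_separations.2 ⟨⟨?_, ?_⟩, rfl⟩, ?_⟩).ne'
    · exact mul_nonneg (by positivity) (Finset.prod_nonneg (hfac T))
    · exact Finset.nodup_toList _
    · exact fun w hw => ((hmem w).1 hw).1
    · refine mul_pos (by positivity) (Finset.prod_pos fun w hw => ?_)
      refine lt_of_le_of_ne (hfac S w hw) (Ne.symm ?_)
      by_cases h0 : M.θ z w = 0
      · rw [if_neg fun hwS => ((hmem w).1 hwS).2 h0, h0]
        norm_num
      · rwa [if_pos ((hmem w).2 ⟨hw, h0⟩)]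

theorem character_of (M : Params ℰ J) (z : Fin J) (E : List ℰ) (t : ℕ) :
    M.character z (FreeMonoid.of (E, t)) = sentenceProb M.dict (M.θ z) E *
      (M.rate z ^ E.length * if E = [] then 1 else Real.exp (-(M.rate z * t))) := by
  simp [character]

/-- The ratio of the values at gaps 1 and 0, on a nonempty sentence of nonzero probability, is `exp
(-rate)`. -/
theorem rate_eq_of_character_eq {M M' : Params ℰ J} (hM : M.InSpace) {z z' : Fin J}
    (hz : (M.classDict z).Nonempty) (h : M'.character z' = M.character z) :
    M'.rate z' = M.rate z := by
  obtain ⟨E, hE, hP⟩ := exists_sentenceProb_ne_zero hM hz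
  have h0 := DFunLike.congr_fun h (FreeMonoid.of (E, 0))
  have h1 := DFunLike.congr_fun h (FreeMonoid.of (E, 1))
  rw [character_of, character_of, if_neg hE, if_neg hE] at h0 h1
  simp only [Nat.cast_zero, mul_zero, neg_zero, Real.exp_zero, mul_one, Nat.cast_one] at h0 h1
  rw [← mul_assoc, ← mul_assoc, h0] at h1
  have hne : sentenceProb M.dict (M.θ z) E * M.rate z ^ E.length ≠ 0 :=
    mul_ne_zero hP (pow_ne_zero _ (hM.rate_pos z).ne')
  simpa using Real.exp_injective (mul_left_cancel₀ hne h1)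

theorem sentenceProb_eq_of_character_eq {M M' : Params ℰ J} (hM : M.InSpace) {z z' : Fin J}
    (hz : (M.classDict z).Nonempty) (h : M'.character z' = M.character z) (E : List ℰ) :
    sentenceProb M'.dict (M'.θ z') E = sentenceProb M.dict (M.θ z) E := by
  have h0 := DFunLike.congr_fun h (FreeMonoid.of (E, 0))
  rw [character_of, character_of, rate_eq_of_character_eq hM hz h] at h0
  refine mul_right_cancel₀ (mul_ne_zero (pow_ne_zero _ (hM.rate_pos z).ne') ?_) h0
  simp

theorem InSpace.nodup {M : Params ℰ J} (hM : M.InSpace) {w : List ℰ} (hw : w ∈ M.dict) :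
    w.Nodup := by
  by_cases h : 2 ≤ w.length
  · exact hM.a2 w hw h
  · match w, h with
    | [], _ => exact List.nodup_nil
    | [a], _ => exact List.nodup_singleton a
    | a :: b :: w, h => simp at h

/-- Classes with the same conditional density have the same pattern probabilities. -/
theorem θ_eq_of_character_eq {M M' : Params ℰ J} (hM : M.InSpace) (hM' : M'.InSpace)
    {z z' : Fin J} (hz : (M.classDict z).Nonempty) (h : M'.character z' = M.character z)
    {w : List ℰ} (hw : w ∈ M.dict) :
    M.θ z w = if w ∈ M'.dict then M'.θ z' w else 0 := by
  have hmem : ∀ (N : Params ℰ J), N.InSpace → ∀ i, ∀ v ∈ M.dict ∪ M'.dict,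
      (if v ∈ N.dict then N.θ i v else 0) ∈ Set.Icc (0 : ℝ) 1 := by
    intro N hN i v _
    split_ifs with hv
    · exact hN.θ_mem i v hv
    · exact ⟨le_rfl, zero_le_one⟩
  -- Extension by zero to the union puts both models on a common dictionary without changing the
  -- sentence laws.
  have := eq_of_sentenceProb_eq (U := M.dict ∪ M'.dict)
    (θ := fun v => if v ∈ M.dict then M.θ z v else 0)
    (θ' := fun v => if v ∈ M'.dict then M'.θ z' v else 0)
    (fun v hv => by
      rcases Finset.mem_union.1 hv with hv | hv
      · exact ⟨hM.nodup hv, hM.pattern_ne_nil v hv⟩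
      · exact ⟨hM'.nodup hv, hM'.pattern_ne_nil v hv⟩)
    (hmem M hM z) (hmem M' hM' z')
    (fun E => by
      rw [sentenceProb_eq_of_subset Finset.subset_union_left,
        sentenceProb_eq_of_subset Finset.subset_union_right,
        sentenceProb_eq_of_character_eq hM hz h])
    w (Finset.mem_union_left _ hw)
  simpa [hw] using this

theorem character_injective {M : Params ℰ J} (hM : M.InRestrictedSpace) (hidle : M.NoIdle) :
    Function.Injective M.character := by
  intro i₁ i₂ h
  by_contra hne
  have h₁ : i₁ ∈ M.equivClass i₂ := by
    simpa [equivClass] using rate_eq_of_character_eq hM.toInSpace (hidle.class_used i₂) h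
  have h₂ : i₂ ∈ M.equivClass i₂ := by simp [equivClass]
  obtain ⟨I, -, hI, -, -, hrank⟩ := hM.c1 i₂ (Finset.one_lt_card.2 ⟨i₁, h₁, i₂, h₂, hne⟩)
  obtain ⟨e, he, hθ⟩ := exists_tMatrix_col_ne (hrank 0) h₁ h₂ hne
  have hdict : [e] ∈ M.dict := by
    have : e ∈ ⋃ k, (I k : Set ℰ) := Set.mem_iUnion.2 ⟨0, he⟩
    rwa [hI] at this
  have := θ_eq_of_character_eq hM.toInSpace hM.toInSpace (hidle.class_used i₂) h hdict
  rw [if_pos hdict] at this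
  exact hθ this.symm

end Params

end LatentTheme

/-! ### Matching the classes and the dictionaries -/

open LatentTheme Params in
theorem theorem1 {ℰ : Type*} [DecidableEq ℰ] {J : ℕ} (M : LatentTheme.Params ℰ J)
    (hM : M.InRestrictedSpace) (hidle : M.NoIdle) : M.IsIdentifiable := by
  classical
  intro M' hM' hdens _ hcard
  have hmass := fun φ => sum_weight_eq_of_sum_mul_eq
    (sum_weight_mul_character_eq hM.toInSpace hM' hdens) φ
  have hinj := character_injective hM hidle
  have hsingle : ∀ j, ∑ i with M.character i = M.character j, M.weight i = M.weight j := by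
    intro j
    rw [Finset.sum_eq_single_of_mem j (by simp)]
    intro i hi hij
    exact absurd (hinj (Finset.mem_filter.1 hi).2) hij
  have hex : ∀ j, ∃ i, M'.character i = M.character j := by
    intro j
    -- The weight of this character is positive in `M`, so it cannot be absent from `M'`.
    have h1 : ∑ i with M'.character i = M.character j, M'.weight i ≠ 0 := by
      rw [hmass, hsingle]
      exact (hM.weight_pos j).ne'
    obtain ⟨i, hi, -⟩ := Finset.exists_ne_zero_of_sum_ne_zero h1
    exact ⟨i, (Finset.mem_filter.1 hi).2⟩
  choose r hr using hex
  have hrinj : Function.Injective r := fun i j hij => hinj (by rw [← hr, ← hr, hij])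
  have hrsurj : Function.Surjective r := Finite.surjective_of_injective hrinj
  have hθ : ∀ j, ∀ w ∈ M.dict, M.θ j w = if w ∈ M'.dict then M'.θ (r j) w else 0 :=
    fun j w hw => θ_eq_of_character_eq hM.toInSpace hM' (hidle.class_used j) (hr j) hw
  have hsub : M.dict ⊆ M'.dict := by
    intro w hw
    obtain ⟨j, hj⟩ := hidle.dict_used w hw
    by_contra hc
    have := hθ j w hw
    rw [if_neg hc] at this
    exact (Finset.mem_filter.1 hj).2 this
  -- The size bound excludes patterns that `M'` lists with probability zero in every class.
  have hdict : M.dict = M'.dict := Finset.eq_of_subset_of_card_le hsub hcard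
  have hrbij : Function.Bijective r := ⟨hrinj, hrsurj⟩
  refine ⟨hdict.symm, κ_eq_of_density_eq hM.toInSpace hM' hdens,
    Equiv.ofBijective r hrbij, fun j => ⟨fun w hw => ?_, ?_, ?_⟩⟩
  · rw [hθ j w hw, if_pos (hsub hw)]
    rfl
  · exact rate_eq_of_character_eq hM.toInSpace (hidle.class_used j) (hr j)
  · rw [← hsingle j, ← hmass (M.character j), Equiv.ofBijective_apply,
      Finset.sum_eq_single_of_mem (r j) (by simp [hr])]
    intro i hi hij
    obtain ⟨k, rfl⟩ := hrsurj i
    have hk := (Finset.mem_filter.1 hi).2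
    rw [hr] at hk
    exact absurd (congrArg r (hinj hk)) hij
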